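/- Let $X=\{x\in\mathbb{R}^3:\|x\|_\infty=1\}$ be the unit sphere of $\mathbb{R}^3$ with the sup norm (the surface of the cube $[-1,1]^3$), and let the geodesic distance between two points of $X$ be the infimum of the lengths, measured with the sup norm, of all continuous curves in $X$ joining them. Let $A=(1,a,b)\in X$ and $B=(-1,c,d)\in X$. Then the geodesic distance between $A$ and $B$ is equal to the minimum of the following twelve numbers: \begin{align*} s_1&=4-a-c, & s_2&=4+a+c,\\ s_3&=4-b-d, & s_4&=4+b+d,\\ s_5&=\max\{2-a-d,\,4-b-c\}, & s_6&=\max\{2-a+d,\,4+b-c\},\\ s_7&=\max\{2+a-d,\,4-b+c\}, & s_8&=\max\{2+a+d,\,4+b+c\},\\ s_9&=\max\{2-b-c,\,4-a-d\}, & s_{10}&=\max\{2+b-c,\,4-a+d\},\\ s_{11}&=\max\{2-b+c,\,4+a-d\}, & s_{12}&=\max\{2+b+c,\,4+a+d\}. \end{align*} The minimum is $s_1$ (that is, $s_1\le s_j$ for all $j$) if and only if at least one of the following conditions is satisfied: \begin{itemize} \item $|b|\le a$ and $|d|\le c$; \item $c=-d=1$ and $b\ge -a$; \item $c=d=1$ and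 $b\le a$; \item $a=-b=1$ and $d\ge -c$; \item $a=b=1$ and $d\le c$. \end{itemize} The minimum is $s_6$ (that is, $s_6\le s_j$ for all $j$) if and only if at least one of the following conditions is satisfied: \begin{itemize} \item $a+b\le 0$ and $c+d\ge 0$ and $|a+d|\le c-b$ and $b+d\le a+c$ and $b\le 0$ and $c\ge 0$; \item $b=-1$ and $c\ge 0$ and $-c\le d\le 1+a+c$; \item $b=-1$ and $d\ge 1-a-c$; \item $c=1$ and $b\le 0$ and $b+d-1\le a\le -b$; \item $c=1$ and $a\le -1-b-d$. \end{itemize} -/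

import Mathlib

open scoped ENNReal

noncomputable section

/-- The unit sphere `{x : ‖x‖ = 1}` of `ℝ³` for the sup norm, i.e. the surface of the cube
`[-1, 1]³`. (`Fin 3 → ℝ` carries the sup norm in Mathlib.) -/
abbrev cubeSurface : Set (Fin 3 → ℝ) := Metric.sphere (0 : Fin 3 → ℝ) 1

/-- The geodesic (intrinsic) distance of a metric space `X`: the infimum of the lengths of all
continuous curves in `X` from `x` to `y`, where the length of a curve is its total variation for
the metric of `X`. It is `∞` if there is no curve of finite length from `x` to `y`. -/
def geodesicEDist {X : Type*} [PseudoEMetricSpace X] (x y : X) : ℝ≥0∞ :=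
  ⨅ γ : Path x y, eVariationOn (γ : unitInterval → X) Set.univ

/-- The twelve numbers `s₁, …, s₁₂`; `sNum a b c d i` is `s_{i+1}` since `Fin 12` starts at `0`. -/
def sNum (a b c d : ℝ) : Fin 12 → ℝ :=
  ![4 - a - c,
    4 + a + c,
    4 - b - d,
    4 + b + d,
    max (2 - a - d) (4 - b - c),
    max (2 - a + d) (4 + b - c),
    max (2 + a - d) (4 - b + c),
    max (2 + a + d) (4 + b + c),
    max (2 - b - c) (4 - a - d),
    max (2 + b - c) (4 - a + d),
    max (2 - b + c) (4 + a - d),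
    max (2 + b + c) (4 + a + d)]

/-- The minimum of the twelve numbers. -/
def sMin (a b c d : ℝ) : ℝ := Finset.univ.inf' Finset.univ_nonempty (sNum a b c d)

end

/-!
The distance is bounded above by explicit curves. A curve that runs straight on each face has the
sum of the sup distances of its successive edge crossings as its length. The route through one side
face gives `s₁` (`geodesicLE_three_faces`), the route through two side faces gives `s₆`
(`geodesicLE_four_faces`), and the symmetries of the cube that preserve the faces `x = 1` and
`x = -1` turn these into all twelve bounds (`geodesicLE_sNum`).

For the lower bound, let `f` be a real function on the cube surface that is `1`-Lipschitz on each
face. Cutting a curve at its last visits to the faces shows that the length of a curve from `p` to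
`q` is at least `|f q - f p|` (`edist_le_geodesicEDist_of_closed_cover`), although `f` need not be
`1`-Lipschitz across an edge. This is applied to `distFrom a b`, which should be thought of as the
distance from `A`: it is the sup distance on the front face, a minimum over three unfoldings on each
side face (`sideDist`), and `sMin a b` on the back face. On each face it is built from coordinates
by minima and maxima, hence `1`-Lipschitz, so that only the agreement of the formulas along the
edges has to be checked. That `distFrom a b` is the distance is not needed, only that it takes
the values `0` at `A` and `sMin a b c d` at `B`.

The two characterizations of the minimizing index are linear arithmetic with case distinctions.
-/

/-! ### Geodesic distance in metric spaces -/

theorem geodesicEDist_triangle {X : Type*} [PseudoEMetricSpace X] (x y z : X) :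
    geodesicEDist x z ≤ geodesicEDist x y + geodesicEDist y z := by
  unfold geodesicEDist
  simp only [ENNReal.iInf_add, ENNReal.add_iInf]
  refine le_iInf fun q => le_iInf fun p => ?_
  refine (iInf_le _ (p.trans q)).trans ?_
  have hm : (1 / 2 : ℝ) ∈ unitInterval := by constructor <;> norm_num
  -- The two halves of the concatenated curve are monotone reparametrizations of `p` and `q`.
  have hu : (Set.univ : Set unitInterval) = Set.Iic ⟨1 / 2, hm⟩ ∪ Set.Ici ⟨1 / 2, hm⟩ :=
    Set.Iic_union_Ici.symm
  rw [hu, eVariationOn.union _ isGreatest_Iic isLeast_Ici, ← hu]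
  refine add_le_add ?_ ?_
  · have h : Set.EqOn (p.trans q) (p ∘ fun t : unitInterval =>
        Set.projIcc (0 : ℝ) 1 zero_le_one (2 * t)) (Set.Iic ⟨1 / 2, hm⟩) := by
      intro t ht
      have ht' : (t : ℝ) ≤ 1 / 2 := ht
      rw [Path.trans_apply, dif_pos ht', Function.comp_apply,
        Set.projIcc_of_mem zero_le_one ⟨by linarith [t.2.1], by linarith⟩]
    rw [eVariationOn.congr h]
    refine eVariationOn.comp_le_of_monotoneOn _ _ (fun s _ t _ hst => ?_) (Set.mapsTo_univ _ _)
    exact Set.monotone_projIcc _ (by have : (s : ℝ) ≤ t := hst; linarith)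
  · have h : Set.EqOn (p.trans q) (q ∘ fun t : unitInterval =>
        Set.projIcc (0 : ℝ) 1 zero_le_one (2 * t - 1)) (Set.Ici ⟨1 / 2, hm⟩) := by
      intro t ht
      have ht' : 1 / 2 ≤ (t : ℝ) := ht
      rw [Function.comp_apply,
        Set.projIcc_of_mem zero_le_one ⟨by linarith, by linarith [t.2.2]⟩, Path.trans_apply]
      split_ifs with h'
      · have h2 : (t : ℝ) = 1 / 2 := le_antisymm h' ht'
        simp [h2]
      · rfl
    rw [eVariationOn.congr h]
    refine eVariationOn.comp_le_of_monotoneOn _ _ (fun s _ t _ hst => ?_) (Set.mapsTo_univ _ _)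
    exact Set.monotone_projIcc _ (by have : (s : ℝ) ≤ t := hst; linarith)

theorem LipschitzWith.geodesicEDist_le {X Y : Type*} [PseudoEMetricSpace X] [PseudoEMetricSpace Y]
    {φ : X → Y} (hφ : LipschitzWith 1 φ) (x y : X) :
    geodesicEDist (φ x) (φ y) ≤ geodesicEDist x y := by
  refine le_iInf fun γ => (iInf_le _ (γ.map hφ.continuous)).trans ?_
  simpa using hφ.lipschitzOnWith.comp_eVariationOn_le (f := φ) (g := γ) (Set.mapsTo_univ _ _)

theorem geodesicEDist_le_edist_of_segment_subset {E : Type*} [NormedAddCommGroup E]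
    [NormedSpace ℝ E] {S : Set E} (x y : S) (h : segment ℝ (x : E) y ⊆ S) :
    geodesicEDist x y ≤ edist x y := by
  let g : unitInterval → S := fun t =>
    ⟨AffineMap.lineMap (x : E) (y : E) (t : ℝ), h (by
      rw [segment_eq_image_lineMap]; exact ⟨t, t.2, rfl⟩)⟩
  have hg : LipschitzWith (nndist (x : E) (y : E)) g :=
    fun s t => by
      exact lipschitzWith_lineMap (𝕜 := ℝ) (x : E) (y : E) (s : ℝ) (t : ℝ)
  let γ : Path x y :=
    { toFun := g
      continuous_toFun := hg.continuous
      source' := by simp [g]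
      target' := by simp [g] }
  refine (iInf_le _ γ).trans ?_
  have h1 := hg.lipschitzOnWith.comp_eVariationOn_le (f := g) (g := id)
    (Set.mapsTo_univ id Set.univ)
  have h2 : eVariationOn (id : unitInterval → unitInterval) Set.univ ≤ 1 := by
    have h3 : MonotoneOn (fun t : unitInterval => (t : ℝ)) Set.univ := fun _ _ _ _ h => h
    have h4 := h3.eVariationOn_eq (Set.mem_univ 0) (Set.mem_univ 1)
    rw [Set.univ_inter, show Set.Icc (0 : unitInterval) 1 = Set.univ from Set.Icc_bot_top] at h4
    change eVariationOn (fun t : unitInterval => (t : ℝ)) Set.univ ≤ 1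
    simp [h4]
  calc eVariationOn γ Set.univ ≤ _ := h1
    _ ≤ (nndist (x : E) (y : E)) * 1 := by gcongr
    _ = edist x y := by rw [mul_one, Subtype.edist_eq, edist_nndist]

/-- If a curve stays in finitely many closed sets on each of which `f` is `1`-Lipschitz, then `f`
moves by at most the length of the curve. No Lipschitz bound is needed between points of different
sets: the curve is cut at its last visits to the sets. -/
theorem edist_le_eVariationOn_Icc_of_closed_cover {X Y ι : Type*} [PseudoEMetricSpace X]
    [PseudoEMetricSpace Y] [DecidableEq ι] {F : ι → Set X} (hF : ∀ i, IsClosed (F i)) {f : X → Y}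
    (hf : ∀ i, LipschitzOnWith 1 f (F i)) {γ : unitInterval → X} (hγ : Continuous γ)
    (I : Finset ι) {s t : unitInterval} (hst : s ≤ t)
    (hI : ∀ u ∈ Set.Icc s t, ∃ i ∈ I, γ u ∈ F i) :
    edist (f (γ s)) (f (γ t)) ≤ eVariationOn γ (Set.Icc s t) := by
  induction I using Finset.strongInduction generalizing s with
  | H I ih =>
    obtain ⟨i, hi, hsi⟩ := hI s ⟨le_rfl, hst⟩
    -- `m` is the last time in `[s, t]` at which the curve is in `F i`.
    obtain ⟨m, ⟨hm, hmi⟩, hmax⟩ :=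
      (isCompact_Icc.inter_right ((hF i).preimage hγ)).exists_isGreatest ⟨s, ⟨le_rfl, hst⟩, hsi⟩
    have h1 : edist (f (γ s)) (f (γ m)) ≤ eVariationOn γ (Set.Icc s m) := by
      refine le_trans ?_ (eVariationOn.edist_le γ ⟨le_rfl, hm.1⟩ ⟨hm.1, le_rfl⟩)
      simpa using hf i hsi hmi
    rcases hm.2.eq_or_lt with rfl | hlt
    · exact h1
    -- After `m` the curve avoids `F i`, so the other sets, whose union is closed, cover `[m, t]`.
    have hcl : Set.Icc m t ⊆ γ ⁻¹' ⋃ j ∈ I.erase i, F j := by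
      rw [← closure_Ioc hlt.ne]
      refine closure_minimal (fun u hu => ?_)
        ((isClosed_biUnion_finset fun j _ => hF j).preimage hγ)
      obtain ⟨j, hj, huj⟩ := hI u ⟨hm.1.trans hu.1.le, hu.2⟩
      have hji : j ≠ i := by
        rintro rfl
        exact absurd (hmax ⟨⟨hm.1.trans hu.1.le, hu.2⟩, huj⟩) (not_le.mpr hu.1)
      exact Set.mem_biUnion (Finset.mem_erase.mpr ⟨hji, hj⟩) huj
    have h2 := ih (I.erase i) (Finset.erase_ssubset hi) hm.2 fun u hu => by
      simpa using hcl hu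
    rw [← Set.Icc_union_Icc_eq_Icc hm.1 hm.2,
      eVariationOn.union γ (isGreatest_Icc hm.1) (isLeast_Icc hm.2)]
    exact (edist_triangle _ _ _).trans (add_le_add h1 h2)

theorem edist_le_geodesicEDist_of_closed_cover {X Y ι : Type*} [PseudoEMetricSpace X]
    [PseudoEMetricSpace Y] [Fintype ι] [DecidableEq ι] {F : ι → Set X} (hF : ∀ i, IsClosed (F i))
    (hcover : ∀ x, ∃ i, x ∈ F i) {f : X → Y} (hf : ∀ i, LipschitzOnWith 1 f (F i)) (x y : X) :
    edist (f x) (f y) ≤ geodesicEDist x y := by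
  refine le_iInf fun γ => ?_
  have h := edist_le_eVariationOn_Icc_of_closed_cover hF hf γ.continuous Finset.univ
    (zero_le_one (α := unitInterval)) fun u _ => by simpa using hcover (γ u)
  rw [γ.source, γ.target] at h
  exact h.trans (eVariationOn.mono _ (Set.subset_univ _))

/-! ### Upper bounds from explicit curves on the cube -/

theorem mem_cubeSurface_iff {v : Fin 3 → ℝ} :
    v ∈ cubeSurface ↔ (∀ i, |v i| ≤ 1) ∧ ∃ i, |v i| = 1 := by
  rw [mem_sphere_zero_iff_norm]
  constructor
  · intro h
    refine ⟨fun i => h ▸ norm_le_pi_norm v i, ?_⟩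
    by_contra! hne
    refine absurd h ((pi_norm_lt_iff one_pos).mpr fun i => ?_).ne
    exact lt_of_le_of_ne (h ▸ norm_le_pi_norm v i) (hne i)
  · rintro ⟨h, i, hi⟩
    exact le_antisymm ((pi_norm_le_iff_of_nonneg zero_le_one).mpr h) (hi ▸ norm_le_pi_norm v i)

theorem geodesicEDist_le_of_mem_face {x y : cubeSurface} (i : Fin 3) (hxy : x.1 i = y.1 i)
    (hi : |x.1 i| = 1) {r : ℝ} (hr : ∀ j, |x.1 j - y.1 j| ≤ r) :
    geodesicEDist x y ≤ ENNReal.ofReal r := by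
  have hr0 : 0 ≤ r := (abs_nonneg _).trans (hr 0)
  refine (geodesicEDist_le_edist_of_segment_subset x y fun v hv => ?_).trans ?_
  · have hball : v ∈ Metric.closedBall (0 : Fin 3 → ℝ) 1 :=
      (convex_closedBall _ _).segment_subset (Metric.sphere_subset_closedBall x.2)
        (Metric.sphere_subset_closedBall y.2) hv
    obtain ⟨s, t, -, -, hst, rfl⟩ := hv
    rw [mem_closedBall_zero_iff, pi_norm_le_iff_of_nonneg zero_le_one] at hball
    refine mem_cubeSurface_iff.mpr ⟨hball, i, ?_⟩
    simp only [Pi.add_apply, Pi.smul_apply, smul_eq_mul]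
    rw [← hxy, ← add_mul, hst, one_mul, hi]
  · rw [edist_dist]
    exact ENNReal.ofReal_le_ofReal ((dist_pi_le_iff hr0).mpr hr)

theorem mem_cubeSurface_vec {x y z : ℝ} : ![x, y, z] ∈ cubeSurface ↔
    ((-1 ≤ x ∧ x ≤ 1) ∧ (-1 ≤ y ∧ y ≤ 1) ∧ (-1 ≤ z ∧ z ≤ 1)) ∧
      (|x| = 1 ∨ |y| = 1 ∨ |z| = 1) := by
  rw [mem_cubeSurface_iff]
  simp [Fin.forall_fin_succ, Fin.exists_fin_succ, abs_le]

/-- The geodesic distance between `(1, a, b)` and `(-1, c, d)` is at most `s`, whenever both points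
lie on the cube surface. -/
def GeodesicLE (a b c d s : ℝ) : Prop :=
  ∀ (hA : (![1, a, b] : Fin 3 → ℝ) ∈ cubeSurface) (hB : (![-1, c, d] : Fin 3 → ℝ) ∈ cubeSurface),
    geodesicEDist (⟨![1, a, b], hA⟩ : cubeSurface) ⟨![-1, c, d], hB⟩ ≤ ENNReal.ofReal s

/-- The reflection `(x, y, z) ↦ (x, -y, z)` is an isometry of the cube surface. -/
theorem GeodesicLE.flip {a b c d s : ℝ} (h : GeodesicLE (-a) b (-c) d s) :
    GeodesicLE a b c d s := by
  intro hA hB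
  have hmem : ∀ v : cubeSurface, ![v.1 0, -v.1 1, v.1 2] ∈ cubeSurface := fun v => by
    have := mem_cubeSurface_iff.mp v.2
    simp only [mem_cubeSurface_iff, Fin.forall_fin_succ, Fin.exists_fin_succ] at this ⊢
    simpa using this
  have hφ : LipschitzWith 1 fun v : cubeSurface => (⟨_, hmem v⟩ : cubeSurface) :=
    LipschitzWith.of_dist_le_mul fun v w => by
      have hvw := (dist_pi_le_iff dist_nonneg).mp (le_refl (dist v.1 w.1))
      rw [NNReal.coe_one, one_mul]
      refine (dist_pi_le_iff dist_nonneg).mpr fun i => ?_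
      fin_cases i
      · exact hvw 0
      · simpa [Subtype.dist_eq] using hvw 1
      · exact hvw 2
  have hA' : ![1, -a, b] ∈ cubeSurface := hmem ⟨_, hA⟩
  have hB' : ![-1, -c, d] ∈ cubeSurface := hmem ⟨_, hB⟩
  simpa using (hφ.geodesicEDist_le ⟨_, hA'⟩ ⟨_, hB'⟩).trans (h hA' hB')

/-- The reflection `(x, y, z) ↦ (x, z, y)` is an isometry of the cube surface. -/
theorem GeodesicLE.swap {a b c d s : ℝ} (h : GeodesicLE b a d c s) : GeodesicLE a b c d s := by
  intro hA hB
  have hmem : ∀ v : cubeSurface, ![v.1 0, v.1 2, v.1 1] ∈ cubeSurface := fun v => by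
    have := mem_cubeSurface_iff.mp v.2
    simp only [mem_cubeSurface_iff, Fin.forall_fin_succ, Fin.exists_fin_succ] at this ⊢
    simp at this ⊢
    tauto
  have hφ : LipschitzWith 1 fun v : cubeSurface => (⟨_, hmem v⟩ : cubeSurface) :=
    LipschitzWith.of_dist_le_mul fun v w => by
      have hvw := (dist_pi_le_iff dist_nonneg).mp (le_refl (dist v.1 w.1))
      rw [NNReal.coe_one, one_mul]
      refine (dist_pi_le_iff dist_nonneg).mpr fun i => ?_
      fin_cases i
      · exact hvw 0
      · exact hvw 2
      · exact hvw 1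
  have hA' : ![1, b, a] ∈ cubeSurface := hmem ⟨_, hA⟩
  have hB' : ![-1, d, c] ∈ cubeSurface := hmem ⟨_, hB⟩
  simpa using (hφ.geodesicEDist_le ⟨_, hA'⟩ ⟨_, hB'⟩).trans (h hA' hB')

/-- The bound from the route through the face `y = 1` alone, with edge crossings at `(1, 1, b)` and
`(-1, 1, d)`. -/
theorem geodesicLE_three_faces (a b c d : ℝ) : GeodesicLE a b c d (4 - a - c) := by
  intro hA hB
  obtain ⟨⟨-, ha, hb⟩, -⟩ := mem_cubeSurface_vec.mp hA
  obtain ⟨⟨-, hc, hd⟩, -⟩ := mem_cubeSurface_vec.mp hB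
  have hP : ![1, 1, b] ∈ cubeSurface := mem_cubeSurface_vec.mpr (by simp [hb])
  have hQ : ![-1, 1, d] ∈ cubeSurface := mem_cubeSurface_vec.mpr (by simp [hd])
  have h1 : geodesicEDist (⟨_, hA⟩ : cubeSurface) ⟨_, hP⟩ ≤ ENNReal.ofReal (1 - a) :=
    geodesicEDist_le_of_mem_face 0 (by simp) (by simp) (by
      simp [Fin.forall_fin_succ, abs_le]; grind)
  have h2 : geodesicEDist (⟨_, hP⟩ : cubeSurface) ⟨_, hQ⟩ ≤ ENNReal.ofReal 2 :=
    geodesicEDist_le_of_mem_face 1 (by simp) (by simp) (by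
      simp [Fin.forall_fin_succ, abs_le]; grind)
  have h3 : geodesicEDist (⟨_, hQ⟩ : cubeSurface) ⟨_, hB⟩ ≤ ENNReal.ofReal (1 - c) :=
    geodesicEDist_le_of_mem_face 0 (by simp) (by simp) (by
      simp [Fin.forall_fin_succ, abs_le]; grind)
  calc _ ≤ _ := geodesicEDist_triangle _ ⟨_, hP⟩ _
    _ ≤ _ := add_le_add h1 ((geodesicEDist_triangle _ ⟨_, hQ⟩ _).trans (add_le_add h2 h3))
    _ = ENNReal.ofReal (4 - a - c) := by
      rw [← ENNReal.ofReal_add (by norm_num) (by linarith), ← ENNReal.ofReal_add (by linarith)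
        (by linarith)]
      congr 1; ring

/-- The bound from the route through the faces `z = -1` and `y = 1`. It crosses edges at
`(1, e, -1)`, `(1 - r, 1, -1)` and `(-1, 1, f)`. -/
theorem geodesicLE_four_faces (a b c d : ℝ) :
    GeodesicLE a b c d (max (2 - a + d) (4 + b - c)) := by
  intro hA hB
  obtain ⟨⟨-, ha, hb⟩, -⟩ := mem_cubeSurface_vec.mp hA
  obtain ⟨⟨-, hc, hd⟩, -⟩ := mem_cubeSurface_vec.mp hB
  -- A point `(1 - r, 1, -1)` of the edge common to `z = -1` and `y = 1` splits the bound into the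
  -- unfolded sup distances from `A` to that point and from there to `B`.
  obtain ⟨r, hr0, hr2, hr⟩ : ∃ r : ℝ, 0 ≤ r ∧ r ≤ 2 ∧
      max (1 + b + r) (1 - a) + max (3 - c - r) (1 + d) ≤ max (2 - a + d) (4 + b - c) := by
    rcases le_total (2 - a + d) (4 + b - c) with h | h
    · refine ⟨max 0 (-a - b), by grind, by grind, by grind⟩
    · refine ⟨max 0 (2 - c - d), by grind, by grind, by grind⟩
  -- The `y`-coordinate grows as fast as it can on the way down from `A`; the `z`-coordinate does so
  -- on the way to `B`.
  obtain ⟨e, he⟩ : ∃ e, e = min 1 (1 + a + b) := ⟨_, rfl⟩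
  obtain ⟨f, hf⟩ : ∃ f, f = max (-1) (c + d - 1) := ⟨_, rfl⟩
  have hE : ![1, e, -1] ∈ cubeSurface := mem_cubeSurface_vec.mpr ⟨by grind, by simp⟩
  have hP : ![1 - r, 1, -1] ∈ cubeSurface := mem_cubeSurface_vec.mpr ⟨by grind, by simp⟩
  have hF : ![-1, 1, f] ∈ cubeSurface := mem_cubeSurface_vec.mpr ⟨by grind, by simp⟩
  have h1 : geodesicEDist (⟨_, hA⟩ : cubeSurface) ⟨_, hE⟩ ≤ ENNReal.ofReal (1 + b) :=
    geodesicEDist_le_of_mem_face 0 (by simp) (by simp) (by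
      simp [Fin.forall_fin_succ, abs_le]; grind)
  have h2 : geodesicEDist (⟨_, hE⟩ : cubeSurface) ⟨_, hP⟩ ≤ ENNReal.ofReal (max r (1 - e)) :=
    geodesicEDist_le_of_mem_face 2 (by simp) (by simp) (by
      simp [Fin.forall_fin_succ, abs_le]; grind)
  have h3 : geodesicEDist (⟨_, hP⟩ : cubeSurface) ⟨_, hF⟩ ≤ ENNReal.ofReal (max (2 - r) (1 + f)) :=
    geodesicEDist_le_of_mem_face 1 (by simp) (by simp) (by
      simp [Fin.forall_fin_succ, abs_le]; grind)
  have h4 : geodesicEDist (⟨_, hF⟩ : cubeSurface) ⟨_, hB⟩ ≤ ENNReal.ofReal (1 - c) :=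
    geodesicEDist_le_of_mem_face 0 (by simp) (by simp) (by
      simp [Fin.forall_fin_succ, abs_le]; grind)
  calc _ ≤ _ := geodesicEDist_triangle _ ⟨_, hE⟩ _
    _ ≤ _ := add_le_add h1 ((geodesicEDist_triangle _ ⟨_, hP⟩ _).trans (add_le_add h2
      ((geodesicEDist_triangle _ ⟨_, hF⟩ _).trans (add_le_add h3 h4))))
    _ = ENNReal.ofReal (1 + b + (max r (1 - e) + (max (2 - r) (1 + f) + (1 - c)))) := by
      rw [← ENNReal.ofReal_add (by grind) (by grind), ← ENNReal.ofReal_add (by grind) (by grind),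
        ← ENNReal.ofReal_add (by grind) (by grind)]
    _ ≤ _ := ENNReal.ofReal_le_ofReal (by grind)

/-- The isometries fixing the faces `x = 1` and `x = -1`, generated by `flip` and `swap`, carry the
two routes above to all twelve. -/
theorem geodesicLE_sNum (a b c d : ℝ) (i : Fin 12) : GeodesicLE a b c d (sNum a b c d i) := by
  have h1 := geodesicLE_three_faces
  have h6 := geodesicLE_four_faces
  have h2 : ∀ a b c d : ℝ, GeodesicLE a b c d (4 + a + c) := fun a b c d => by
    convert (h1 (-a) b (-c) d).flip using 1; ring
  have h5 : ∀ a b c d : ℝ, GeodesicLE a b c d (max (2 - a - d) (4 - b - c)) := fun a b c d => by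
    convert ((h6 a (-b) c (-d)).swap.flip.swap) using 2 <;> ring
  have h7 : ∀ a b c d : ℝ, GeodesicLE a b c d (max (2 + a - d) (4 - b + c)) := fun a b c d => by
    convert (h5 (-a) b (-c) d).flip using 2 <;> ring
  have h8 : ∀ a b c d : ℝ, GeodesicLE a b c d (max (2 + a + d) (4 + b + c)) := fun a b c d => by
    convert (h6 (-a) b (-c) d).flip using 2 <;> ring
  fin_cases i
  exacts [h1 a b c d, h2 a b c d, (h1 b a d c).swap, (h2 b a d c).swap, h5 a b c d, h6 a b c d,
    h7 a b c d, h8 a b c d, (h5 b a d c).swap, (h7 b a d c).swap, (h6 b a d c).swap,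
    (h8 b a d c).swap]

/-! ### A function that is 1-Lipschitz on every face -/

/-- The distance from `(1, a, b)` to the point `(x, 1, z)` of the side face `y = 1`: the minimum over
the direct route and the routes through the faces `z = 1` and `z = -1`. The other side faces reduce
to this one by symmetry. -/
noncomputable def sideDist (a b x z : ℝ) : ℝ :=
  min (max (2 - a - x) |z - b|) (min (max (2 - b - x) (2 - a - z)) (max (2 + b - x) (2 - a + z)))

/-- The distance from `(1, a, b)`, given by a formula on each face of the cube. On an edge the first
applicable formula is used; the formulas of both faces agree there by `distFrom_right`,
`distFrom_left`, `distFrom_top` and `distFrom_bottom`. -/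
noncomputable def distFrom (a b : ℝ) (p : cubeSurface) : ℝ :=
  if p.1 0 = 1 then max |p.1 1 - a| |p.1 2 - b|
  else if p.1 0 = -1 then sMin a b (p.1 1) (p.1 2)
  else if p.1 1 = 1 then sideDist a b (p.1 0) (p.1 2)
  else if p.1 1 = -1 then sideDist (-a) b (p.1 0) (p.1 2)
  else if p.1 2 = 1 then sideDist b a (p.1 0) (p.1 1)
  else sideDist (-b) a (p.1 0) (p.1 1)

theorem sideDist_flip (a b x z : ℝ) : sideDist a (-b) x (-z) = sideDist a b x z := by
  simp only [sideDist, abs_sub_comm z b]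
  rw [show |(-z) - (-b)| = |b - z| by ring_nf, min_comm (max (2 - -b - x) _)]
  simp [sub_eq_add_neg]

theorem sideDist_le_add {a b x z x' z' δ : ℝ} (hx : |x - x'| ≤ δ) (hz : |z - z'| ≤ δ) :
    sideDist a b x z ≤ sideDist a b x' z' + δ := by
  rw [abs_le] at hx hz
  unfold sideDist
  simp only [← min_add_add_right, ← max_add_add_right]
  have h := abs_sub_le z z' b
  have h' : |z - z'| ≤ δ := abs_le.mpr hz
  exact min_le_min (max_le_max (by linarith) (by linarith))
    (min_le_min (max_le_max (by linarith) (by linarith))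
      (max_le_max (by linarith) (by linarith)))

/-- On the edge between the faces `x = 1` and `y = 1` the two formulas of `distFrom` agree. -/
theorem sideDist_front {a b z : ℝ} (ha : -1 ≤ a ∧ a ≤ 1) (hb : -1 ≤ b ∧ b ≤ 1)
    (hz : -1 ≤ z ∧ z ≤ 1) : sideDist a b 1 z = max |1 - a| |z - b| := by
  unfold sideDist
  rw [abs_of_nonneg (by linarith : 0 ≤ 1 - a)]
  rcases abs_cases (z - b) with h | h <;> grind

/-- On the edge between the faces `y = 1` and `z = 1` the two formulas of `distFrom` agree. -/
theorem sideDist_swap {a b x : ℝ} (ha : -1 ≤ a ∧ a ≤ 1) (hb : -1 ≤ b ∧ b ≤ 1)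
    (hx : -1 ≤ x ∧ x ≤ 1) : sideDist a b x 1 = sideDist b a x 1 := by
  unfold sideDist
  rw [abs_of_nonneg (by linarith : 0 ≤ 1 - a), abs_of_nonneg (by linarith : 0 ≤ 1 - b)]
  grind

theorem le_sMin_iff {a b c d t : ℝ} :
    t ≤ sMin a b c d ↔ t ≤ 4 - a - c ∧ t ≤ 4 + a + c ∧ t ≤ 4 - b - d ∧ t ≤ 4 + b + d ∧
      t ≤ max (2 - a - d) (4 - b - c) ∧ t ≤ max (2 - a + d) (4 + b - c) ∧
      t ≤ max (2 + a - d) (4 - b + c) ∧ t ≤ max (2 + a + d) (4 + b + c) ∧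
      t ≤ max (2 - b - c) (4 - a - d) ∧ t ≤ max (2 + b - c) (4 - a + d) ∧
      t ≤ max (2 - b + c) (4 + a - d) ∧ t ≤ max (2 + b + c) (4 + a + d) := by
  rw [sMin, Finset.le_inf'_iff]
  simp only [Finset.mem_univ, true_imp_iff, Fin.forall_fin_succ, IsEmpty.forall_iff, and_true]
  rfl

theorem sMin_le_add {a b c d c' d' δ : ℝ} (hc : |c - c'| ≤ δ) (hd : |d - d'| ≤ δ) :
    sMin a b c d ≤ sMin a b c' d' + δ := by
  rw [abs_le] at hc hd
  rw [← sub_le_iff_le_add, le_sMin_iff]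
  have h := le_sMin_iff.mp (le_refl (sMin a b c d))
  simp only [sub_le_iff_le_add, ← max_add_add_right]
  refine ⟨?_, ?_, ?_, ?_, ?_, ?_, ?_, ?_, ?_, ?_, ?_, ?_⟩
  · linarith
  · linarith
  · linarith
  · linarith
  · exact h.2.2.2.2.1.trans (max_le_max (by linarith) (by linarith))
  · exact h.2.2.2.2.2.1.trans (max_le_max (by linarith) (by linarith))
  · exact h.2.2.2.2.2.2.1.trans (max_le_max (by linarith) (by linarith))
  · exact h.2.2.2.2.2.2.2.1.trans (max_le_max (by linarith) (by linarith))
  · exact h.2.2.2.2.2.2.2.2.1.trans (max_le_max (by linarith) (by linarith))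
  · exact h.2.2.2.2.2.2.2.2.2.1.trans (max_le_max (by linarith) (by linarith))
  · exact h.2.2.2.2.2.2.2.2.2.2.1.trans (max_le_max (by linarith) (by linarith))
  · exact h.2.2.2.2.2.2.2.2.2.2.2.trans (max_le_max (by linarith) (by linarith))

theorem sMin_flip (a b c d : ℝ) : sMin (-a) b (-c) d = sMin a b c d := by
  refine eq_of_forall_le_iff fun t => ?_
  simp only [le_sMin_iff, sub_neg_eq_add, ← sub_eq_add_neg]
  tauto

theorem sMin_swap (a b c d : ℝ) : sMin b a d c = sMin a b c d := by
  refine eq_of_forall_le_iff fun t => ?_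
  simp only [le_sMin_iff]
  tauto

/-- On the edge between the faces `x = -1` and `y = 1` the two formulas of `distFrom` agree: the
minimum is attained by `s₁`, `s₅` or `s₆` there. -/
theorem sideDist_back {a b d : ℝ} (ha : -1 ≤ a ∧ a ≤ 1) (hb : -1 ≤ b ∧ b ≤ 1)
    (hd : -1 ≤ d ∧ d ≤ 1) : sideDist a b (-1) d = sMin a b 1 d := by
  have h : sideDist a b (-1) d =
      min (3 - a) (min (max (3 - b) (2 - a - d)) (max (3 + b) (2 - a + d))) := by
    unfold sideDist
    rcases abs_cases (d - b) with h | h <;> grind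
  rw [h]
  have hm := le_sMin_iff.mp (le_refl (sMin a b 1 d))
  refine le_antisymm (le_sMin_iff.mpr ?_) (le_min ?_ (le_min ?_ ?_))
  · refine ⟨?_, ?_, ?_, ?_, ?_, ?_, ?_, ?_, ?_, ?_, ?_, ?_⟩ <;> clear hm h <;> grind
  · linarith [hm.1]
  · refine hm.2.2.2.2.1.trans_eq ?_
    grind
  · refine hm.2.2.2.2.2.1.trans_eq ?_
    grind

theorem coord_mem (p : cubeSurface) (i : Fin 3) : -1 ≤ p.1 i ∧ p.1 i ≤ 1 :=
  abs_le.mp ((mem_cubeSurface_iff.mp p.2).1 i)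

theorem distFrom_front {a b : ℝ} {p : cubeSurface} (h : p.1 0 = 1) :
    distFrom a b p = max |p.1 1 - a| |p.1 2 - b| :=
  if_pos h

theorem distFrom_back {a b : ℝ} {p : cubeSurface} (h : p.1 0 = -1) :
    distFrom a b p = sMin a b (p.1 1) (p.1 2) := by
  rw [distFrom, if_neg (by rw [h]; norm_num), if_pos h]

theorem distFrom_right {a b : ℝ} (ha : -1 ≤ a ∧ a ≤ 1) (hb : -1 ≤ b ∧ b ≤ 1)
    {p : cubeSurface} (h : p.1 1 = 1) :
    distFrom a b p = sideDist a b (p.1 0) (p.1 2) := by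
  by_cases h0 : p.1 0 = 1
  · rw [distFrom_front h0, h, h0, sideDist_front ha hb (coord_mem p 2)]
  by_cases h1 : p.1 0 = -1
  · rw [distFrom_back h1, h, h1, sideDist_back ha hb (coord_mem p 2)]
  rw [distFrom, if_neg h0, if_neg h1, if_pos h]

theorem distFrom_left {a b : ℝ} (ha : -1 ≤ a ∧ a ≤ 1) (hb : -1 ≤ b ∧ b ≤ 1)
    {p : cubeSurface} (h : p.1 1 = -1) :
    distFrom a b p = sideDist (-a) b (p.1 0) (p.1 2) := by
  have ha' : -1 ≤ -a ∧ -a ≤ 1 := ⟨by linarith, by linarith⟩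
  by_cases h0 : p.1 0 = 1
  · rw [distFrom_front h0, h, h0, sideDist_front ha' hb (coord_mem p 2), abs_sub_comm,
      sub_neg_eq_add, sub_neg_eq_add, add_comm]
  by_cases h1 : p.1 0 = -1
  · rw [distFrom_back h1, h, h1, sideDist_back ha' hb (coord_mem p 2), ← sMin_flip, neg_neg]
  rw [distFrom, if_neg h0, if_neg h1, if_neg (by rw [h]; norm_num), if_pos h]

theorem distFrom_top {a b : ℝ} (ha : -1 ≤ a ∧ a ≤ 1) (hb : -1 ≤ b ∧ b ≤ 1)
    {p : cubeSurface} (h : p.1 2 = 1) :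
    distFrom a b p = sideDist b a (p.1 0) (p.1 1) := by
  have ha' : -1 ≤ -a ∧ -a ≤ 1 := ⟨by linarith, by linarith⟩
  by_cases h0 : p.1 0 = 1
  · rw [distFrom_front h0, h, h0, sideDist_front hb ha (coord_mem p 1), max_comm]
  by_cases h1 : p.1 0 = -1
  · rw [distFrom_back h1, h, h1, sideDist_back hb ha (coord_mem p 1), sMin_swap]
  by_cases h2 : p.1 1 = 1
  · rw [distFrom_right ha hb h2, h, h2, sideDist_swap ha hb (coord_mem p 0)]
  by_cases h3 : p.1 1 = -1
  · rw [distFrom_left ha hb h3, h, h3, sideDist_swap ha' hb (coord_mem p 0), ← sideDist_flip b a,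
      neg_neg]
  rw [distFrom, if_neg h0, if_neg h1, if_neg h2, if_neg h3, if_pos h]

theorem distFrom_bottom {a b : ℝ} (ha : -1 ≤ a ∧ a ≤ 1) (hb : -1 ≤ b ∧ b ≤ 1)
    {p : cubeSurface} (h : p.1 2 = -1) :
    distFrom a b p = sideDist (-b) a (p.1 0) (p.1 1) := by
  have ha' : -1 ≤ -a ∧ -a ≤ 1 := ⟨by linarith, by linarith⟩
  have hb' : -1 ≤ -b ∧ -b ≤ 1 := ⟨by linarith, by linarith⟩
  by_cases h0 : p.1 0 = 1
  · rw [distFrom_front h0, h, h0, sideDist_front hb' ha (coord_mem p 1), max_comm,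
      abs_sub_comm (-1) b, sub_neg_eq_add, sub_neg_eq_add, add_comm]
  by_cases h1 : p.1 0 = -1
  · rw [distFrom_back h1, h, h1, sideDist_back hb' ha (coord_mem p 1), ← sMin_swap, ← sMin_flip,
      neg_neg]
  by_cases h2 : p.1 1 = 1
  · rw [distFrom_right ha hb h2, h, h2, ← sideDist_swap ha hb' (coord_mem p 0), ← sideDist_flip,
      neg_neg]
  by_cases h3 : p.1 1 = -1
  · rw [distFrom_left ha hb h3, h, h3, ← sideDist_flip (-b) a, neg_neg,
      ← sideDist_swap ha' hb' (coord_mem p 0), ← sideDist_flip, neg_neg]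
  rw [distFrom, if_neg h0, if_neg h1, if_neg h2, if_neg h3, if_neg (by rw [h]; norm_num)]

/-- On every face `distFrom` is built by minima and maxima from functions of one coordinate with slope
at most `1`. -/
theorem distFrom_lipschitzOnWith_face {a b : ℝ} (ha : -1 ≤ a ∧ a ≤ 1) (hb : -1 ≤ b ∧ b ≤ 1)
    (i : Fin 3) (σ : Bool) :
    LipschitzOnWith 1 (distFrom a b) {p : cubeSurface | p.1 i = if σ then 1 else -1} := by
  refine LipschitzOnWith.of_le_add fun p hp q hq => ?_
  have hpq : ∀ j, |p.1 j - q.1 j| ≤ dist p q := fun j => dist_le_pi_dist p.1 q.1 j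
  fin_cases i <;> cases σ <;>
    simp only [Set.mem_ofPred_eq, if_true, Bool.false_eq_true, if_false] at hp hq
  · rw [distFrom_back hp, distFrom_back hq]
    exact sMin_le_add (hpq 1) (hpq 2)
  · rw [distFrom_front hp, distFrom_front hq, ← max_add_add_right]
    exact max_le_max (by linarith [abs_sub_le (p.1 1) (q.1 1) a, hpq 1])
      (by linarith [abs_sub_le (p.1 2) (q.1 2) b, hpq 2])
  · rw [distFrom_left ha hb hp, distFrom_left ha hb hq]
    exact sideDist_le_add (hpq 0) (hpq 2)
  · rw [distFrom_right ha hb hp, distFrom_right ha hb hq]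
    exact sideDist_le_add (hpq 0) (hpq 2)
  · rw [distFrom_bottom ha hb hp, distFrom_bottom ha hb hq]
    exact sideDist_le_add (hpq 0) (hpq 1)
  · rw [distFrom_top ha hb hp, distFrom_top ha hb hq]
    exact sideDist_le_add (hpq 0) (hpq 1)

theorem edist_distFrom_le_geodesicEDist {a b : ℝ} (ha : -1 ≤ a ∧ a ≤ 1) (hb : -1 ≤ b ∧ b ≤ 1)
    (p q : cubeSurface) :
    edist (distFrom a b p) (distFrom a b q) ≤ geodesicEDist p q := by
  refine edist_le_geodesicEDist_of_closed_cover
    (F := fun j : Fin 3 × Bool => {p : cubeSurface | p.1 j.1 = if j.2 then 1 else -1})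
    (fun j => ?_) (fun p => ?_) (fun j => distFrom_lipschitzOnWith_face ha hb j.1 j.2) p q
  · exact isClosed_eq ((continuous_apply j.1).comp continuous_subtype_val) continuous_const
  · obtain ⟨i, hi⟩ := (mem_cubeSurface_iff.mp p.2).2
    rcases (abs_eq zero_le_one).mp hi with h | h
    · exact ⟨(i, true), by simpa using h⟩
    · exact ⟨(i, false), by simpa using h⟩

/-! ### The minimizing index -/

theorem sMin_eq_iff (a b c d : ℝ) (j : Fin 12) :
    sMin a b c d = sNum a b c d j ↔ ∀ i, sNum a b c d j ≤ sNum a b c d i := by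
  constructor
  · intro h i
    rw [← h]
    exact Finset.inf'_le _ (Finset.mem_univ i)
  · intro h
    exact le_antisymm (Finset.inf'_le _ (Finset.mem_univ j)) (Finset.le_inf' _ _ fun i _ => h i)

theorem sMin_eq_sNum_zero_iff {a b c d : ℝ} (ha : |a| ≤ 1) (hb : |b| ≤ 1)
    (hc : |c| ≤ 1) (hd : |d| ≤ 1) :
    sMin a b c d = sNum a b c d 0 ↔
      (|b| ≤ a ∧ |d| ≤ c) ∨
      ((c = 1 ∧ -d = 1) ∧ b ≥ -a) ∨
      ((c = 1 ∧ d = 1) ∧ b ≤ a) ∨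
      ((a = 1 ∧ -b = 1) ∧ d ≥ -c) ∨
      ((a = 1 ∧ b = 1) ∧ d ≤ c) := by
  rw [sMin_eq_iff]
  rw [abs_le] at ha hb hc hd
  simp only [Fin.forall_fin_succ, sNum, Fin.isValue]
  simp [abs_le]
  constructor
  · intro h
    grind (splits := 40)
  · intro h
    rcases h with h | h | h | h | h <;>
      refine ⟨?_, ?_, ?_, ?_, ?_, ?_, ?_, ?_, ?_, ?_, ?_⟩ <;> grind

theorem sMin_eq_sNum_five_iff {a b c d : ℝ} (ha : |a| ≤ 1) (hb : |b| ≤ 1)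
    (hc : |c| ≤ 1) (hd : |d| ≤ 1) :
    sMin a b c d = sNum a b c d 5 ↔
      (a + b ≤ 0 ∧ c + d ≥ 0 ∧ |a + d| ≤ c - b ∧ b + d ≤ a + c ∧ b ≤ 0 ∧ c ≥ 0) ∨
      (b = -1 ∧ c ≥ 0 ∧ -c ≤ d ∧ d ≤ 1 + a + c) ∨
      (b = -1 ∧ d ≥ 1 - a - c) ∨
      (c = 1 ∧ b ≤ 0 ∧ b + d - 1 ≤ a ∧ a ≤ -b) ∨
      (c = 1 ∧ a ≤ -1 - b - d) := by
  rw [sMin_eq_iff]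
  rw [abs_le] at ha hb hc hd
  simp only [Fin.forall_fin_succ, sNum, Fin.isValue]
  simp [abs_le]
  constructor
  · intro h
    grind (splits := 40)
  · intro h
    rcases h with h | h | h | h | h <;>
      refine ⟨?_, ?_, ?_, ?_, ?_, ?_, ?_, ?_, ?_, ?_, ?_⟩ <;> grind

/-! ### The distance formula -/

theorem theorem2 (a b c d : ℝ)
    (hA : (![1, a, b] : Fin 3 → ℝ) ∈ cubeSurface)
    (hB : (![-1, c, d] : Fin 3 → ℝ) ∈ cubeSurface) :
    geodesicEDist (⟨![1, a, b], hA⟩ : cubeSurface) (⟨![-1, c, d], hB⟩ : cubeSurface)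
        = ENNReal.ofReal (sMin a b c d) ∧
    (sMin a b c d = sNum a b c d 0 ↔
      (|b| ≤ a ∧ |d| ≤ c) ∨
      ((c = 1 ∧ -d = 1) ∧ b ≥ -a) ∨
      ((c = 1 ∧ d = 1) ∧ b ≤ a) ∨
      ((a = 1 ∧ -b = 1) ∧ d ≥ -c) ∨
      ((a = 1 ∧ b = 1) ∧ d ≤ c)) ∧
    (sMin a b c d = sNum a b c d 5 ↔
      (a + b ≤ 0 ∧ c + d ≥ 0 ∧ |a + d| ≤ c - b ∧ b + d ≤ a + c ∧ b ≤ 0 ∧ c ≥ 0) ∨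
      (b = -1 ∧ c ≥ 0 ∧ -c ≤ d ∧ d ≤ 1 + a + c) ∨
      (b = -1 ∧ d ≥ 1 - a - c) ∨
      (c = 1 ∧ b ≤ 0 ∧ b + d - 1 ≤ a ∧ a ≤ -b) ∨
      (c = 1 ∧ a ≤ -1 - b - d)) := by
  obtain ⟨⟨-, ha, hb⟩, -⟩ := mem_cubeSurface_vec.mp hA
  obtain ⟨⟨-, hc, hd⟩, -⟩ := mem_cubeSurface_vec.mp hB
  refine ⟨le_antisymm ?_ ?_, sMin_eq_sNum_zero_iff (abs_le.mpr ha) (abs_le.mpr hb) (abs_le.mpr hc)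
    (abs_le.mpr hd), sMin_eq_sNum_five_iff (abs_le.mpr ha) (abs_le.mpr hb) (abs_le.mpr hc)
    (abs_le.mpr hd)⟩
  · obtain ⟨i, -, hi⟩ := Finset.exists_mem_eq_inf' Finset.univ_nonempty (sNum a b c d)
    rw [sMin, hi]
    exact geodesicLE_sNum a b c d i hA hB
  · refine le_trans ?_ (edist_distFrom_le_geodesicEDist ha hb _ _)
    rw [distFrom_front (by simp), distFrom_back (by simp), edist_comm, edist_dist]
    refine ENNReal.ofReal_le_ofReal ((le_abs_self _).trans_eq ?_)
    simp
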